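/- **Definitions.** Let $\mu$ be a probability measure on $\mathbb R$ with CDF $Q_\mu$. - $\mu$ is $\sigma$-sub-Gaussian ($\sigma>0$) if it has a mean and $\Pr[|X-\mathbb E X|\ge t]\le 2e^{-t^2/\sigma^2}$ for all $t\ge 0$, where $X\sim\mu$. It is $\alpha$-sub-Weibull with constant $c$ ($\alpha>0$) if $\Pr[|X|\ge t]\le c\,e^{-t^{1/\alpha}}$ for all $t\ge 0$. - $\mu$ has $\ell$-bi-Lipschitz CDF ($\ell>0$) if $\frac1\ell|x-y|\le|Q_\mu(x)-Q_\mu(y)|\le \ell|x-y|$ for all $x,y\in\operatorname{supp}\mu$. - $W_p(\mu,\nu)=\big(\inf_\pi\int|x-y|^p\,d\pi(x,y)\big)^{1/p}$, where the infimum is over all couplings $\pi$ of $\mu$ and $\nu$. - Algorithm MMG with $k$ counters keeps a set $T$ of at most $k$ items, initially empty, with a counter $c(x)$ for each $x\in T$. On an item $x$ of weight $\Delta$: if $x\in T$, or if $|T|<k$ (then $x$ is put into $T$ with counter $0$), $\Delta$ is added to $c(x)$. Otherwise let $d$ be the $\lfloor k/2\rfloor$-th largest counter value; $d$ is subtracted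 from all counters, the items whose counter becomes $\le 0$ are removed from $T$, and, if $\Delta\ge d$, $x$ is put into $T$ with counter $\Delta-d$. - Algorithm SCA with bucket width $b$, reference point $x_0$ and $k$ counters reads real numbers $X_1,X_2,\dots$ and feeds to MMG, with weight $1$, the index $i=\lfloor (X_j-x_0)/b\rfloor$ of the bucket $[x_0+ib,\,x_0+(i+1)b]$ containing $X_j$. With $\hat C(i)=\sum_{j\in T,\,j\le i}c(j)$, it returns the approximate CDF $\hat Q(i)=\hat C(i)/\max_j\hat C(j)$. The output $\hat\mu_n$ is the measure that places mass $\hat Q(i)-\hat Q(i-1)$ at a chosen representative point $r_i$ of the $i$-th bucket. **Theorem (Universal Learning of SCA in $W_p$).** Let $X_1,\dots,X_n$ be i.i.d. samples from $\mu$ with empirical measure $\mu_n=\frac1n\sum_j\delta_{X_j}$. Suppose that $\mu$ has $\ell$-bi-Lipschitz CDF, let $p\ge1$ and $\varepsilon,\delta\in(0,1)$, and let $k\ge 4$ be an integer. (a) There is a universal constant $C>0$ such that, if $\mu$ is $\sigma$-sub-Gaussian, $$n\ge C\log(1/\delta)\max\{1/\ell^2,\ell^2\}\quad\text{and}\quad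 k\ge C\,\frac{\sigma}{\varepsilon}\log\frac{\ell}{\varepsilon},$$ then SCA with bucket width $b=\varepsilon/2$ and $k$ counters never stores more than $k$ buckets and $$\Pr\big[W_p(\mu_n,\hat\mu_n)\ge\varepsilon\big]\le\delta .$$ (b) For all $\alpha>0$ and $c$ there is a constant $C>0$, depending only on $\alpha$ and $c$, such that the same conclusion holds if $\mu$ is $\alpha$-sub-Weibull with constant $c$, $$n\ge C\log(1/\delta)\max\{1/\varepsilon,1/\ell^2,\ell^2\}\quad\text{and}\quad k\ge \frac{C}{\varepsilon}\Big(\log\frac{\ell}{\varepsilon}\Big)^{\alpha}.$$ Both hold for every reference point $x_0\in\mathbb R$ and every choice of representative points $r_i$ in the buckets. -/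

import Mathlib

open MeasureTheory

namespace StreamSummary

/-! ### The mergeable Misra-Gries algorithm -/

/-- Memory of the algorithm: the finite set `T` of items that currently own a counter, and the
values of the counters (the values off `T` are never read; a counter that is freed is `0`). -/
structure MMGState (ι : Type*) where
  T : Finset ι
  c : ι → ℕ

namespace MMGState

variable {ι : Type*} [DecidableEq ι]

/-- `Initialize`: no item owns a counter. -/
def init : MMGState ι := ⟨∅, fun _ => 0⟩

/-- The `r`-th largest value (`r ≥ 1`), counting multiplicity, in the multiset
`{c j : j ∈ T}`; it is `0` if there are fewer than `r` values. -/
def kthLargest (s : MMGState ι) (r : ℕ) : ℕ :=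
  ((s.T.val.map s.c).sort (fun a b => b ≤ a)).getD (r - 1) 0

/-- `DecrementCounters`: subtract `d` from all counters and free those that become `≤ 0`.
The subtraction is the truncated one, so that a freed counter holds `0`. -/
def decrement (s : MMGState ι) (d : ℕ) : MMGState ι :=
  ⟨s.T.filter (fun j => d < s.c j), fun j => s.c j - d⟩

/-- Give `x` a counter (if it has none) and add `w` to it. -/
def add (s : MMGState ι) (x : ι) (w : ℕ) : MMGState ι :=
  ⟨insert x s.T, Function.update s.c x (s.c x + w)⟩

/-- `Update(x, Δ)` with `k` counters.  If `x` owns a counter, or if a counter is free, `Δ` is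
added to the counter of `x`.  Otherwise all counters are decreased by `d`, the `k/2`-th largest
value, and `x` is inserted with the value `Δ - d` if `d ≤ Δ`. -/
def update (k : ℕ) (s : MMGState ι) (x : ι) (Δ : ℕ) : MMGState ι :=
  if x ∈ s.T ∨ s.T.card < k then s.add x Δ
  else
    let d := s.kthLargest (k / 2)
    if d ≤ Δ then (s.decrement d).add x (Δ - d) else s.decrement d

/-- `Estimate(x)`: the value of the counter of `x`, and `0` if there is none. -/
def estimate (s : MMGState ι) (x : ι) : ℕ := if x ∈ s.T then s.c x else 0

/-- `EstimateCumulate(i)`: the sum of the estimates of all items `j ≤ i`. -/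
def estimateCumulate (s : MMGState ℤ) (i : ℤ) : ℕ :=
  ∑ j ∈ s.T.filter (fun j => j ≤ i), s.estimate j

/-- `max_j EstimateCumulate(j)`; the maximum is attained at an item that owns a counter
(and it is `0` if there is no such item). -/
def maxCumulate (s : MMGState ℤ) : ℕ := s.T.sup s.estimateCumulate

end MMGState

/-! ### The sublinear CDF learner `SCA` -/

/-- The bucket `[x₀ + i b, x₀ + (i + 1) b]`. -/
def bucket (x₀ b : ℝ) (i : ℤ) : Set ℝ := Set.Icc (x₀ + i * b) (x₀ + (i + 1) * b)

/-- The index of the bucket of width `b` that contains `x`. -/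
noncomputable def bucketIndex (x₀ b x : ℝ) : ℤ := ⌊(x - x₀) / b⌋

/-- The memory of `SCA`, with bucket width `b`, reference point `x₀` and `k` counters, after it has
read the stream `ζ`: for each stream element the counter of its bucket is updated with weight 1. -/
noncomputable def scaState (k : ℕ) (x₀ b : ℝ) (ζ : List ℝ) : MMGState ℤ :=
  ζ.foldl (fun s x => s.update k (bucketIndex x₀ b x) 1) MMGState.init

/-- The approximate CDF which `SCA` returns, as a function of the bucket index. -/
noncomputable def scaCDF (k : ℕ) (x₀ b : ℝ) (ζ : List ℝ) (i : ℤ) : ℝ :=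
  ((scaState k x₀ b ζ).estimateCumulate i : ℝ) / ((scaState k x₀ b ζ).maxCumulate : ℝ)

/-- The summary measure on the real line that `SCA` outputs: the increment of `scaCDF` at bucket
`i` is the mass placed at the point `rep i` representing that bucket.  (The increment is zero at
the buckets that do not own a counter.) -/
noncomputable def scaMeasure (k : ℕ) (x₀ b : ℝ) (rep : ℤ → ℝ) (ζ : List ℝ) : Measure ℝ :=
  ∑ i ∈ (scaState k x₀ b ζ).T,
    ENNReal.ofReal (scaCDF k x₀ b ζ i - scaCDF k x₀ b ζ (i - 1)) • Measure.dirac (rep i)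

/-! ### Measures on the line -/

/-- The empirical measure of the samples `x 0, …, x (n - 1)`. -/
noncomputable def empirical {n : ℕ} (x : Fin n → ℝ) : Measure ℝ :=
  (n : ENNReal)⁻¹ • ∑ i, Measure.dirac (x i)

/-- The `p`-th Wasserstein distance on the real line, through couplings; it is `∞` if there is
no coupling. -/
noncomputable def wasserstein (p : ℝ) (μ ν : Measure ℝ) : ENNReal :=
  (⨅ π ∈ {π : Measure (ℝ × ℝ) | π.map Prod.fst = μ ∧ π.map Prod.snd = ν},
    ∫⁻ z, ENNReal.ofReal (|z.1 - z.2| ^ p) ∂π) ^ (1 / p)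

/-- `μ` is `σ`-sub-Gaussian. -/
def IsSubGaussian (μ : Measure ℝ) (σ : ℝ) : Prop :=
  Integrable (fun x : ℝ => x) μ ∧
    ∀ t : ℝ, 0 ≤ t → μ.real {x | t ≤ |x - ∫ y, y ∂μ|} ≤ 2 * Real.exp (-(t ^ 2 / σ ^ 2))

/-- `μ` is `α`-sub-Weibull with tail constant `c`. -/
def IsSubWeibull (μ : Measure ℝ) (α c : ℝ) : Prop :=
  ∀ t : ℝ, 0 ≤ t → μ.real {x | t ≤ |x|} ≤ c * Real.exp (-(t ^ (1 / α)))

/-- The CDF of `μ`, as a function on the support of `μ`, is `ℓ`-bi-Lipschitz. -/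
def HasBiLipschitzCDF (μ : Measure ℝ) (ℓ : ℝ) : Prop :=
  0 < ℓ ∧ ∀ x ∈ μ.support, ∀ y ∈ μ.support,
    1 / ℓ * |x - y| ≤ |ProbabilityTheory.cdf μ x - ProbabilityTheory.cdf μ y| ∧
    |ProbabilityTheory.cdf μ x - ProbabilityTheory.cdf μ y| ≤ ℓ * |x - y|

/-- On a stream of `n` i.i.d. samples from `μ`, `SCA` with bucket width `ε / 2` and `k` counters
never stores more than `k` buckets, and with probability at least `1 - δ` its output is
closer than `ε` in `W_p` to the empirical measure.  This holds for every reference point `x₀` of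
the buckets and every choice of the points `rep i` representing the buckets. -/
def SCALearns (μ : Measure ℝ) (p ε δ : ℝ) (n k : ℕ) : Prop :=
  ∀ (x₀ : ℝ) (rep : ℤ → ℝ), (∀ i, rep i ∈ bucket x₀ (ε / 2) i) →
    (∀ (x : Fin n → ℝ) (m : ℕ), m ≤ n →
      (scaState k x₀ (ε / 2) ((List.ofFn x).take m)).T.card ≤ k) ∧
    Measure.pi (fun _ : Fin n => μ)
      {x | ENNReal.ofReal ε ≤
        wasserstein p (empirical x) (scaMeasure k x₀ (ε / 2) rep (List.ofFn x))}
      ≤ ENNReal.ofReal δ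

end StreamSummary

/-!
The lower Lipschitz bound, together with the decay of the tails, forces the support of `μ` to be
so small that it meets at most `k` buckets. The output of the algorithm is then almost surely the
empirical measure moved to the representatives of the buckets (`scaMeasure_ofFn`). It is at
distance at most `ε / 2` from the empirical measure, for every `p`, by matching each sample with
its representative (`wasserstein_empirical_le`). So the event `ε ≤ W_p` has probability zero as
soon as there is a sample at all.

The support is controlled as follows. Two points `x ≤ y` of the support satisfy
`y - x ≤ ℓ * μ (x, y]`. In particular the diameter of the support is at most `ℓ`, and four buckets
suffice if `ℓ < 3 / 2 * ε`. Otherwise `log (ℓ / ε) ≥ 1 / 3`, and the tail hypothesis gives a radius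
`R` with `μ {R ≤ |x - m|} ≤ ε / (8 * ℓ)`, where `R` is of order `σ * log (ℓ / ε)` around the mean
`m` in the sub-Gaussian case, and of order `log (ℓ / ε) ^ α` around `m = 0` in the sub-Weibull
case. Any stretch of the support outside of `[m - R, m + R]` then has length at most `ε / 8`, up to
one possible long gap to the left (`HasBiLipschitzCDF.exists_support_subset`). So the support lies
in an interval of length `ε / 8` and an interval of length `2 * R + ε / 8`. These meet at most
`2` and about `4 * R / ε + 2` buckets, which is at most `k`; this includes the case of `k = 4`, as
each of the intervals meets at most two buckets if `R` is small compared with `ε`.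
-/

namespace StreamSummary

open ProbabilityTheory

/-! ### The counters of the algorithm -/

namespace MMGState

variable {ι : Type*}

/-- Decreasing all counters by the value of one of them frees at least that one. -/
lemma card_decrement_lt (s : MMGState ι) {r : ℕ} (hr : 0 < r) (hrs : r ≤ s.T.card) :
    (s.decrement (s.kthLargest r)).T.card < s.T.card := by
  have hlen : r - 1 < ((s.T.val.map s.c).sort (fun a b => b ≤ a)).length := by
    simp only [Multiset.length_sort, Multiset.card_map, Finset.card_val]
    omega
  have hmem : s.kthLargest r ∈ s.T.val.map s.c := by
    rw [← Multiset.mem_sort (r := fun a b : ℕ => b ≤ a), kthLargest,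
      List.getD_eq_getElem _ _ hlen]
    exact List.getElem_mem hlen
  obtain ⟨j, hj, hjd⟩ := Multiset.mem_map.1 hmem
  refine Finset.card_lt_card (Finset.filter_ssubset.2 ⟨j, hj, ?_⟩)
  rw [hjd]
  exact lt_irrefl _

variable [DecidableEq ι]

lemma card_update_le {k : ℕ} (hk : 2 ≤ k) (s : MMGState ι) (hs : s.T.card ≤ k) (x : ι) (w : ℕ) :
    (s.update k x w).T.card ≤ k := by
  by_cases h : x ∈ s.T ∨ s.T.card < k
  · simp only [update, h, if_true, add]
    rcases h with h | h
    · rwa [Finset.insert_eq_of_mem h]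
    · exact (Finset.card_insert_le _ _).trans h
  · have hlt := s.card_decrement_lt (r := k / 2) (by omega) (by omega)
    simp only [update, h, if_false]
    split_ifs
    · exact (Finset.card_insert_le _ _).trans (hlt.trans_le hs)
    · exact hlt.le.trans hs

lemma card_foldl_update_le {k : ℕ} (hk : 2 ≤ k) {X : Type*} (f : X → ι) (ζ : List X) :
    (ζ.foldl (fun s x => s.update k (f x) 1) init).T.card ≤ k := by
  induction ζ using List.reverseRecOn with
  | nil => simp [init]
  | append_singleton ζ x ih =>
    rw [List.foldl_append]
    exact card_update_le hk _ ih _ _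

/-- If the stream meets at most `k` distinct items, no counter is ever decreased, so that the
counters hold the exact frequencies. -/
lemma foldl_update_eq_count {k : ℕ} {X : Type*} (f : X → ι) (ζ : List X) (J : Finset ι)
    (hJ : J.card ≤ k) (hf : ∀ x ∈ ζ, f x ∈ J) :
    ζ.foldl (fun s x => s.update k (f x) 1) init =
      ⟨(ζ.map f).toFinset, fun j => (ζ.map f).count j⟩ := by
  induction ζ using List.reverseRecOn with
  | nil => simp [init]
  | append_singleton ζ x ih =>
    have hsub : (ζ.map f).toFinset ⊆ J := by
      intro j hj
      obtain ⟨y, hy, rfl⟩ := List.mem_map.1 (List.mem_toFinset.1 hj)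
      exact hf y (by simp [hy])
    have hfree : f x ∈ (ζ.map f).toFinset ∨ (ζ.map f).toFinset.card < k := by
      by_contra! h
      have hss : (ζ.map f).toFinset ⊂ J :=
        Finset.ssubset_iff_subset_ne.2 ⟨hsub, fun e => h.1 (e ▸ hf x (by simp))⟩
      have := Finset.card_lt_card hss
      omega
    rw [List.foldl_append, ih fun y hy => hf y (by simp [hy])]
    simp only [List.foldl_cons, List.foldl_nil, update, hfree, if_true, add, mk.injEq]
    constructor
    · ext j
      simp only [Finset.mem_insert, List.mem_toFinset, List.map_append, List.mem_append,
        List.map_cons, List.map_nil, List.mem_singleton]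
      tauto
    · funext j
      by_cases hj : j = f x
      · subst hj
        simp
      · rw [Function.update_of_ne hj]
        simp [Ne.symm hj]

end MMGState

/-! ### Exactness of the output when the stream meets few buckets -/

section Exact

variable {k n : ℕ} {x₀ b : ℝ} {J : Finset ℤ}

lemma estimateCumulate_scaState {ζ : List ℝ} (hJ : J.card ≤ k)
    (hζ : ∀ x ∈ ζ, bucketIndex x₀ b x ∈ J) (i : ℤ) :
    (scaState k x₀ b ζ).estimateCumulate i =
      ∑ j ∈ (ζ.map (bucketIndex x₀ b)).toFinset.filter (fun j => j ≤ i),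
        (ζ.map (bucketIndex x₀ b)).count j := by
  rw [scaState, MMGState.foldl_update_eq_count _ ζ J hJ hζ, MMGState.estimateCumulate]
  refine Finset.sum_congr rfl fun j hj => ?_
  exact if_pos (Finset.mem_filter.1 hj).1

lemma maxCumulate_scaState {ζ : List ℝ} (hJ : J.card ≤ k)
    (hζ : ∀ x ∈ ζ, bucketIndex x₀ b x ∈ J) :
    (scaState k x₀ b ζ).maxCumulate = ζ.length := by
  have hT : (scaState k x₀ b ζ).T = (ζ.map (bucketIndex x₀ b)).toFinset := by
    rw [scaState, MMGState.foldl_update_eq_count _ ζ J hJ hζ]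
  have htotal : ∑ j ∈ (ζ.map (bucketIndex x₀ b)).toFinset,
      (ζ.map (bucketIndex x₀ b)).count j = ζ.length := by
    rw [List.sum_toFinset_count_eq_length, List.length_map]
  apply le_antisymm
  · refine Finset.sup_le fun i _ => ?_
    rw [estimateCumulate_scaState hJ hζ, ← htotal]
    exact Finset.sum_le_sum_of_subset (Finset.filter_subset _ _)
  · rcases (ζ.map (bucketIndex x₀ b)).toFinset.eq_empty_or_nonempty with he | hne
    · rw [← htotal, he, Finset.sum_empty]
      exact Nat.zero_le _
    · -- The maximum is attained at the rightmost occupied bucket.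
      rw [MMGState.maxCumulate, hT]
      refine le_trans (le_of_eq ?_) (Finset.le_sup (Finset.max'_mem _ hne))
      rw [estimateCumulate_scaState hJ hζ,
        Finset.filter_true_of_mem fun j hj => Finset.le_max' _ j hj, htotal]

lemma scaCDF_sub_scaCDF {ζ : List ℝ} (hJ : J.card ≤ k)
    (hζ : ∀ x ∈ ζ, bucketIndex x₀ b x ∈ J) {i : ℤ}
    (hi : i ∈ (ζ.map (bucketIndex x₀ b)).toFinset) :
    scaCDF k x₀ b ζ i - scaCDF k x₀ b ζ (i - 1) =
      ((ζ.map (bucketIndex x₀ b)).count i : ℝ) / (ζ.length : ℝ) := by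
  have hsplit : (ζ.map (bucketIndex x₀ b)).toFinset.filter (fun j => j ≤ i) =
      insert i ((ζ.map (bucketIndex x₀ b)).toFinset.filter (fun j => j ≤ i - 1)) := by
    ext j
    simp only [Finset.mem_filter, Finset.mem_insert]
    constructor
    · rintro ⟨h1, h2⟩
      rcases h2.lt_or_eq with h | h
      · exact Or.inr ⟨h1, by omega⟩
      · exact Or.inl h
    · rintro (rfl | ⟨h1, h2⟩)
      · exact ⟨hi, le_rfl⟩
      · exact ⟨h1, by omega⟩
  rw [scaCDF, scaCDF, maxCumulate_scaState hJ hζ, estimateCumulate_scaState hJ hζ,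
    estimateCumulate_scaState hJ hζ, hsplit, Finset.sum_insert (by simp)]
  push_cast
  ring

/-- If the samples meet at most `k` buckets, the output is the empirical measure pushed forward
by moving each sample to the representative of its bucket. -/
lemma scaMeasure_ofFn (x : Fin n → ℝ) (hn : 0 < n) (rep : ℤ → ℝ) (hJ : J.card ≤ k)
    (hx : ∀ j, bucketIndex x₀ b (x j) ∈ J) :
    scaMeasure k x₀ b rep (List.ofFn x) =
      (n : ENNReal)⁻¹ • ∑ j, Measure.dirac (rep (bucketIndex x₀ b (x j))) := by
  have hζ : ∀ y ∈ List.ofFn x, bucketIndex x₀ b y ∈ J := by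
    intro y hy
    obtain ⟨j, rfl⟩ := (List.mem_ofFn' x y).1 hy
    exact hx j
  have hT : (scaState k x₀ b (List.ofFn x)).T =
      ((List.ofFn x).map (bucketIndex x₀ b)).toFinset := by
    rw [scaState, MMGState.foldl_update_eq_count _ _ J hJ hζ]
  have hsum : ∑ j, Measure.dirac (rep (bucketIndex x₀ b (x j))) =
      ∑ i ∈ ((List.ofFn x).map (bucketIndex x₀ b)).toFinset,
        ((List.ofFn x).map (bucketIndex x₀ b)).count i • Measure.dirac (rep i) := by
    rw [← Finset.sum_list_map_count, List.map_map, List.map_ofFn, List.sum_ofFn]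
    rfl
  rw [scaMeasure, hT, hsum, Finset.smul_sum]
  refine Finset.sum_congr rfl fun i hi => ?_
  rw [scaCDF_sub_scaCDF hJ hζ hi, List.length_ofFn,
    ENNReal.ofReal_div_of_pos (by exact_mod_cast hn), ENNReal.ofReal_natCast,
    ENNReal.ofReal_natCast, ← Nat.cast_smul_eq_nsmul ENNReal, smul_smul, ENNReal.div_eq_inv_mul]

lemma abs_sub_le_of_mem_bucket (hb : 0 < b) {x r : ℝ}
    (hr : r ∈ bucket x₀ b (bucketIndex x₀ b x)) : |x - r| ≤ b := by
  have h1 := (le_div_iff₀ hb).1 (Int.floor_le ((x - x₀) / b))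
  have h2 := (div_lt_iff₀ hb).1 (Int.lt_floor_add_one ((x - x₀) / b))
  obtain ⟨h3, h4⟩ := hr
  simp only [bucketIndex] at h3 h4
  rw [abs_le]
  constructor <;> linarith

/-- Matching `x j` with `y j` is a coupling of the two empirical measures. -/
lemma wasserstein_empirical_le {p : ℝ} (hp : 1 ≤ p) (hb : 0 ≤ b) (hn : 0 < n) (x y : Fin n → ℝ)
    (hxy : ∀ j, |x j - y j| ≤ b) :
    wasserstein p (empirical x) (empirical y) ≤ ENNReal.ofReal b := by
  have hp0 : 0 < p := by linarith
  set π : Measure (ℝ × ℝ) := (n : ENNReal)⁻¹ • ∑ j, Measure.dirac (x j, y j) with hπ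
  have hcost : ∫⁻ z, ENNReal.ofReal (|z.1 - z.2| ^ p) ∂π ≤ ENNReal.ofReal (b ^ p) := by
    rw [hπ, lintegral_smul_measure, lintegral_finsetSum_measure]
    have hle : ∑ j, ∫⁻ z, ENNReal.ofReal (|z.1 - z.2| ^ p) ∂(Measure.dirac (x j, y j)) ≤
        (n : ENNReal) * ENNReal.ofReal (b ^ p) := by
      refine (Finset.sum_le_card_nsmul _ _ (ENNReal.ofReal (b ^ p)) fun j _ => ?_).trans
        (by simp)
      rw [lintegral_dirac]
      exact ENNReal.ofReal_le_ofReal (Real.rpow_le_rpow (abs_nonneg _) (hxy j) hp0.le)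
    calc (n : ENNReal)⁻¹ * _ ≤ (n : ENNReal)⁻¹ * ((n : ENNReal) * ENNReal.ofReal (b ^ p)) := by
          gcongr
      _ = ENNReal.ofReal (b ^ p) := by
          rw [← mul_assoc, ENNReal.inv_mul_cancel (by exact_mod_cast hn.ne')
            (ENNReal.natCast_ne_top n), one_mul]
  have hfst : π.map Prod.fst = empirical x := by
    rw [hπ, Measure.map_smul, Measure.map_finset_sum measurable_fst.aemeasurable, empirical]
    simp [Measure.map_dirac' measurable_fst]
  have hsnd : π.map Prod.snd = empirical y := by
    rw [hπ, Measure.map_smul, Measure.map_finset_sum measurable_snd.aemeasurable, empirical]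
    simp [Measure.map_dirac' measurable_snd]
  calc wasserstein p (empirical x) (empirical y) ≤ ENNReal.ofReal (b ^ p) ^ (1 / p) :=
        ENNReal.rpow_le_rpow ((iInf₂_le π ⟨hfst, hsnd⟩).trans hcost) (by positivity)
    _ = ENNReal.ofReal b := by
        rw [← ENNReal.ofReal_rpow_of_nonneg hb hp0.le, ← ENNReal.rpow_mul, mul_one_div_cancel
          hp0.ne', ENNReal.rpow_one]

end Exact

/-- If the support of `μ` meets at most `k` buckets, then almost surely the output is the
bucketed empirical measure, which is within half of `ε` of the empirical measure. -/
lemma SCALearns.of_support {μ : Measure ℝ} [IsProbabilityMeasure μ] {p ε δ : ℝ} {n k : ℕ}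
    (hn : 0 < n) (hk : 2 ≤ k) (hp : 1 ≤ p) (hε : 0 < ε)
    (h : ∀ x₀ : ℝ, ∃ J : Finset ℤ, J.card ≤ k ∧ ∀ x ∈ μ.support, bucketIndex x₀ (ε / 2) x ∈ J) :
    SCALearns μ p ε δ n k := by
  intro x₀ rep hrep
  refine ⟨fun x m _ => MMGState.card_foldl_update_le hk _ _, ?_⟩
  obtain ⟨J, hJ, hJμ⟩ := h x₀
  have hsupp : ∀ᵐ x ∂(Measure.pi fun _ : Fin n => μ), ∀ j, x j ∈ μ.support :=
    Filter.eventually_all.2 fun j => Measure.tendsto_eval_ae_ae.eventually μ.support_mem_ae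
  have hae : ∀ᵐ x ∂(Measure.pi fun _ : Fin n => μ), ¬ ENNReal.ofReal ε ≤
      wasserstein p (empirical x) (scaMeasure k x₀ (ε / 2) rep (List.ofFn x)) := by
    filter_upwards [hsupp] with x hx
    rw [not_le, scaMeasure_ofFn x hn rep hJ fun j => hJμ _ (hx j)]
    refine (wasserstein_empirical_le hp (half_pos hε).le hn x _ fun j =>
      abs_sub_le_of_mem_bucket (half_pos hε) (hrep _)).trans_lt ?_
    exact (ENNReal.ofReal_lt_ofReal_iff hε).2 (half_lt_self hε)
  exact (measure_eq_zero_iff_ae_notMem.2 hae).trans_le zero_le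

/-! ### The support of a measure with bi-Lipschitz CDF -/

section Support

variable {μ : Measure ℝ} [IsProbabilityMeasure μ] {ℓ : ℝ}

/-- The mass between two points of the support bounds their distance. -/
lemma HasBiLipschitzCDF.sub_le (h : HasBiLipschitzCDF μ ℓ) {x y : ℝ} (hx : x ∈ μ.support)
    (hy : y ∈ μ.support) (hxy : x ≤ y) : y - x ≤ ℓ * μ.real (Set.Ioc x y) := by
  have h1 := (h.2 x hx y hy).1
  have hQ : μ.real (Set.Ioc x y) = cdf μ y - cdf μ x := by
    rw [cdf_eq_real, cdf_eq_real, ← Set.Iic_sdiff_Iic, measureReal_sdiff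
      (Set.Iic_subset_Iic.2 hxy) measurableSet_Iic]
  rw [abs_sub_comm, abs_of_nonneg (sub_nonneg.2 hxy), abs_sub_comm, ← hQ,
    abs_of_nonneg measureReal_nonneg, one_div_mul_eq_div, div_le_iff₀ h.1] at h1
  linarith

lemma HasBiLipschitzCDF.sub_le_of_real_le (h : HasBiLipschitzCDF μ ℓ) {x y w : ℝ}
    (hx : x ∈ μ.support) (hy : y ∈ μ.support) (hw0 : 0 ≤ w)
    (hw : ℓ * μ.real (Set.Ioc x y) ≤ w) : y - x ≤ w := by
  rcases le_total x y with hxy | hxy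
  · exact (h.sub_le hx hy hxy).trans hw
  · linarith

/-- A nonempty set whose points are at distance at most `w` lies in an interval of length `w`. -/
lemma exists_subset_Icc_of_sub_le {s : Set ℝ} {w : ℝ} (h : ∀ x ∈ s, ∀ y ∈ s, y - x ≤ w) :
    ∃ A, s ⊆ Set.Icc A (A + w) := by
  rcases s.eq_empty_or_nonempty with rfl | hs
  · exact ⟨0, Set.empty_subset _⟩
  · obtain ⟨z, hz⟩ := hs
    have hbdd : BddBelow s := ⟨z - w, fun x hx => by linarith [h x hx z hz]⟩
    refine ⟨sInf s, fun y hy => ⟨csInf_le hbdd hy, ?_⟩⟩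
    have : y - w ≤ sInf s := le_csInf ⟨z, hz⟩ fun x hx => by linarith [h x hx y hy]
    linarith

lemma HasBiLipschitzCDF.exists_support_subset_Icc (h : HasBiLipschitzCDF μ ℓ) :
    ∃ A, μ.support ⊆ Set.Icc A (A + ℓ) :=
  exists_subset_Icc_of_sub_le fun _ hx _ hy => h.sub_le_of_real_le hx hy h.1.le
    (mul_le_of_le_one_right h.1.le measureReal_le_one)

/-- If `μ` has little mass at distance `R` from `m`, its support reaches only a little beyond
`m + R`, and its part below `m - R` is short. The latter may be far away from `m`: the first
point of the support can be an atom of arbitrarily small mass, followed by a long gap, since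
the mass of that atom does not enter the increments of the CDF on the support. -/
lemma HasBiLipschitzCDF.exists_support_subset (h : HasBiLipschitzCDF μ ℓ) {m R w : ℝ}
    (hw : ℓ * μ.real {x | R ≤ |x - m|} ≤ w) (h1 : μ.real {x | R ≤ |x - m|} < 1) :
    ∃ A, μ.support ⊆ Set.Icc A (A + w) ∪ Set.Icc (m - R) (m + R + w) := by
  have hw0 : 0 ≤ w := le_trans (mul_nonneg h.1.le measureReal_nonneg) hw
  have hℓ := h.1
  obtain ⟨A, hA⟩ := exists_subset_Icc_of_sub_le (s := μ.support ∩ Set.Iio (m - R)) (w := w)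
    fun x hx y hy => h.sub_le_of_real_le hx.1 hy.1 hw0 <| by
      refine le_trans ?_ hw
      have : Set.Ioc x y ⊆ {x | R ≤ |x - m|} := fun z hz => by
        have := hy.2
        rw [Set.mem_Iio] at this
        exact le_trans (by linarith [hz.2]) (neg_le_abs (z - m))
      have := measureReal_mono (μ := μ) this
      gcongr
  refine ⟨A, fun z hz => ?_⟩
  rcases lt_or_ge z (m - R) with hzl | hzl
  · exact Or.inl (hA ⟨hz, hzl⟩)
  refine Or.inr ⟨hzl, ?_⟩
  by_contra! hzr
  have hclosed : IsClosed μ.support := Measure.isClosed_support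
  have hne : (μ.support ∩ Set.Iic (m + R)).Nonempty := by
    by_contra! hemp
    have hfull : μ.support ⊆ {x | R ≤ |x - m|} := fun y hy => by
      by_contra hy'
      have hy2 : y ∈ μ.support ∩ Set.Iic (m + R) := ⟨hy, by
        have := (abs_lt.1 (not_le.1 (show ¬ R ≤ |y - m| from hy'))).2
        rw [Set.mem_Iic]; linarith⟩
      rw [hemp] at hy2
      exact hy2
    have hone : μ {x | R ≤ |x - m|} = 1 :=
      (mem_ae_iff_prob_eq_one (measurableSet_le measurable_const (by fun_prop))).1
        (Filter.mem_of_superset μ.support_mem_ae hfull)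
    rw [measureReal_def, hone] at h1
    simp at h1
  -- The last point `y` of the support before `m + R`: the mass of `(y, z]` lies in the tail.
  have hbdd : BddAbove (μ.support ∩ Set.Iic (m + R)) := ⟨m + R, fun y hy => hy.2⟩
  obtain ⟨hy, hyR⟩ := (hclosed.inter isClosed_Iic).csSup_mem hne hbdd
  set y := sSup (μ.support ∩ Set.Iic (m + R)) with hydef
  rw [Set.mem_Iic] at hyR
  have hmass : μ.real (Set.Ioc y z) ≤ μ.real {x | R ≤ |x - m|} := by
    refine ENNReal.toReal_mono (measure_ne_top _ _) (measure_mono_ae ?_)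
    filter_upwards [μ.support_mem_ae] with t ht htz
    have htR : m + R < t := by
      by_contra! hle
      exact absurd (le_csSup hbdd ⟨ht, hle⟩) (not_le.2 htz.1)
    exact le_trans (by linarith) (le_abs_self (t - m))
  have := h.sub_le_of_real_le hy hz hw0 (le_trans (by gcongr) hw)
  linarith

end Support

/-! ### Counting buckets -/

/-- An interval of length `D` meets at most `⌊D / b⌋ + 2` buckets of width `b`. -/
lemma exists_card_bucketIndex_le {x₀ b D : ℝ} (hb : 0 < b) (u : ℝ) :
    ∃ J : Finset ℤ, J.card ≤ ⌊D / b⌋₊ + 2 ∧ ∀ x ∈ Set.Icc u (u + D), bucketIndex x₀ b x ∈ J := by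
  refine ⟨Finset.Icc (bucketIndex x₀ b u) (bucketIndex x₀ b (u + D)), ?_, fun x hx => ?_⟩
  · have hfl : bucketIndex x₀ b (u + D) ≤ bucketIndex x₀ b u + ⌊D / b⌋₊ + 1 := by
      have e : (u + D - x₀) / b = (u - x₀) / b + D / b := by ring
      have hlt : (u - x₀) / b + D / b < ((⌊(u - x₀) / b⌋ + ⌊D / b⌋₊ + 2 : ℤ) : ℝ) := by
        push_cast
        linarith [Int.lt_floor_add_one ((u - x₀) / b), Nat.lt_floor_add_one (D / b)]
      have := Int.floor_lt.2 hlt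
      rw [bucketIndex, bucketIndex, e]
      omega
    rw [Int.card_Icc]
    omega
  · rw [Finset.mem_Icc]
    constructor
    · exact Int.floor_mono (by gcongr; exact hx.1)
    · exact Int.floor_mono (by gcongr; exact hx.2)

/-- A support of small diameter meets at most four buckets. -/
lemma SCALearns.of_lt {μ : Measure ℝ} [IsProbabilityMeasure μ] {ℓ p ε δ : ℝ} {n k : ℕ}
    (h : HasBiLipschitzCDF μ ℓ) (hn : 0 < n) (hk : 4 ≤ k) (hp : 1 ≤ p) (hε : 0 < ε)
    (hℓ : ℓ < 3 / 2 * ε) : SCALearns μ p ε δ n k := by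
  refine .of_support hn (by omega) hp hε fun x₀ => ?_
  obtain ⟨A, hA⟩ := h.exists_support_subset_Icc
  obtain ⟨J, hJ, hmem⟩ := exists_card_bucketIndex_le (x₀ := x₀) (D := ℓ) (half_pos hε) A
  have : ⌊ℓ / (ε / 2)⌋₊ < 3 :=
    (Nat.floor_lt' (by norm_num)).2 ((div_lt_iff₀ (half_pos hε)).2 (by push_cast; linarith))
  exact ⟨J, by omega, fun x hx => hmem x (hA hx)⟩

/-- A support which is short outside of `[m - R, m + R]` meets few buckets. -/
lemma SCALearns.of_tail {μ : Measure ℝ} [IsProbabilityMeasure μ] {ℓ p ε δ : ℝ} {n k : ℕ}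
    (h : HasBiLipschitzCDF μ ℓ) (hn : 0 < n) (hk : 4 ≤ k) (hp : 1 ≤ p) (hε : 0 < ε)
    (hℓ : 3 / 2 * ε ≤ ℓ) {m R : ℝ}
    (htail : μ.real {x | R ≤ |x - m|} ≤ ε / (8 * ℓ))
    (hkR : ⌊(2 * R + ε / 8) / (ε / 2)⌋₊ + 4 ≤ k) : SCALearns μ p ε δ n k := by
  refine .of_support hn (by omega) hp hε fun x₀ => ?_
  have hℓ0 := h.1
  obtain ⟨A, hA⟩ := h.exists_support_subset (m := m) (R := R) (w := ε / 8)
    ((mul_le_mul_of_nonneg_left htail hℓ0.le).trans_eq (by field_simp))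
    (htail.trans_lt ((div_lt_one (by positivity)).2 (by linarith)))
  obtain ⟨J, hJ, hmem⟩ := exists_card_bucketIndex_le (x₀ := x₀) (D := ε / 8) (half_pos hε) A
  obtain ⟨J', hJ', hmem'⟩ := exists_card_bucketIndex_le (x₀ := x₀) (D := 2 * R + ε / 8)
    (half_pos hε) (m - R)
  have h1 : ⌊ε / 8 / (ε / 2)⌋₊ = 0 :=
    Nat.floor_eq_zero.2 ((div_lt_one (half_pos hε)).2 (by linarith))
  refine ⟨J ∪ J', (Finset.card_union_le _ _).trans (by omega), fun x hx => ?_⟩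
  rw [Finset.mem_union]
  rcases hA hx with hx | hx
  · exact Or.inl (hmem x hx)
  · exact Or.inr (hmem' x ⟨hx.1, hx.2.trans_eq (by ring)⟩)

/-! ### Tails of sub-Gaussian and sub-Weibull measures -/

lemma one_third_le_log_div {ℓ ε : ℝ} (hε : 0 < ε) (hℓ : 3 / 2 * ε ≤ ℓ) :
    1 / 3 ≤ Real.log (ℓ / ε) := by
  have h1 : 3 / 2 ≤ ℓ / ε := (le_div_iff₀ hε).2 hℓ
  have h2 := Real.one_sub_inv_le_log_of_pos (show (0 : ℝ) < 3 / 2 by norm_num)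
  have h3 := Real.log_le_log (by norm_num) h1
  norm_num at h2
  linarith

/-- Exponential decay beyond `log (ℓ / ε)` makes a tail small against `ε / ℓ`. -/
lemma mul_exp_neg_le_div {ℓ ε c s : ℝ} (hε : 0 < ε) (hℓ : 0 < ℓ) (hc : 0 < c)
    (hs : Real.log (8 * c) + Real.log (ℓ / ε) ≤ s) : c * Real.exp (-s) ≤ ε / (8 * ℓ) := by
  rw [← Real.log_mul (by positivity) (by positivity), Real.log_le_iff_le_exp (by positivity)] at hs
  rw [Real.exp_neg, ← div_eq_mul_inv, div_le_div_iff₀ (Real.exp_pos _) (by positivity)]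
  calc c * (8 * ℓ) = ε * (8 * c * (ℓ / ε)) := by field_simp
    _ ≤ ε * Real.exp s := by gcongr

lemma pos_of_mul_log_mul_le {C δ M : ℝ} {n : ℕ} (hC : 0 < C) (hδ : δ ∈ Set.Ioo (0 : ℝ) 1)
    (hM : 0 < M) (h : C * (Real.log (1 / δ) * M) ≤ n) : 0 < n := by
  have hlog : 0 < Real.log (1 / δ) := Real.log_pos ((one_lt_div hδ.1).2 hδ.2)
  have : (0 : ℝ) < n := lt_of_lt_of_le (by positivity) h
  exact_mod_cast this

lemma IsSubGaussian.scaLearns {μ : Measure ℝ} [IsProbabilityMeasure μ] {σ ℓ p ε δ : ℝ} {n k : ℕ}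
    (hσ : 0 < σ) (hμ : IsSubGaussian μ σ) (h : HasBiLipschitzCDF μ ℓ) (hn : 0 < n) (hk : 4 ≤ k)
    (hp : 1 ≤ p) (hε : 0 < ε) (hkC : 168 * (σ / ε * Real.log (ℓ / ε)) ≤ k) :
    SCALearns μ p ε δ n k := by
  rcases lt_or_ge ℓ (3 / 2 * ε) with hℓ | hℓ
  · exact .of_lt h hn hk hp hε hℓ
  have hL := one_third_le_log_div hε hℓ
  set L := Real.log (ℓ / ε) with hLdef
  have hR : 0 ≤ 6 * σ * L := by positivity
  have hlog16 : Real.log (8 * 2) ≤ 3 := by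
    rw [show (8 * 2 : ℝ) = 2 ^ 4 by norm_num, Real.log_pow]
    push_cast
    linarith [Real.log_two_lt_d9]
  refine .of_tail h hn hk hp hε hℓ ((hμ.2 _ hR).trans ?_) ?_
  · refine mul_exp_neg_le_div hε h.1 two_pos ?_
    rw [show (6 * σ * L) ^ 2 / σ ^ 2 = 36 * L ^ 2 by field_simp; ring, ← hLdef]
    nlinarith
  · set x := σ / ε * L with hx
    have e : (2 * (6 * σ * L) + ε / 8) / (ε / 2) = 24 * x + 1 / 4 := by
      rw [hx]; field_simp; ring
    rw [e]
    -- If the long interval is shorter than a bucket, there are at most `2 + 2` buckets, and `4 ≤ k`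
    -- suffices; otherwise the additive constants are absorbed into a multiple of `x`.
    rcases lt_or_ge (24 * x) (3 / 4) with hlt | hge
    · rw [Nat.floor_eq_zero.2 (by linarith)]
      omega
    · have h1 := Nat.floor_le (show 0 ≤ 24 * x + 1 / 4 by linarith)
      have : ((⌊24 * x + 1 / 4⌋₊ + 4 : ℕ) : ℝ) ≤ k := by
        push_cast
        linarith
      exact_mod_cast this

lemma IsSubWeibull.scaLearns {μ : Measure ℝ} [IsProbabilityMeasure μ] {α c ℓ p ε δ : ℝ}
    {n k : ℕ} (hα : 0 < α) (hμ : IsSubWeibull μ α c) (h : HasBiLipschitzCDF μ ℓ) (hn : 0 < n)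
    (hk : 4 ≤ k) (hp : 1 ≤ p) (hε : ε ∈ Set.Ioo (0 : ℝ) 1)
    (hkC : 9 * (1 + 3 * Real.log (8 * max c 1)) ^ α * (1 / ε * Real.log (ℓ / ε) ^ α) ≤ k) :
    SCALearns μ p ε δ n k := by
  obtain ⟨hε0, hε1⟩ := hε
  rcases lt_or_ge ℓ (3 / 2 * ε) with hℓ | hℓ
  · exact .of_lt h hn hk hp hε0 hℓ
  have hL := one_third_le_log_div hε0 hℓ
  set L := Real.log (ℓ / ε) with hLdef
  have hlog : 1 ≤ Real.log (8 * max c 1) := by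
    rw [Real.le_log_iff_exp_le (by positivity)]
    linarith [Real.exp_one_lt_d9, le_max_right c 1]
  -- As `3 * L ≥ 1`, the constant `log (8 * max c 1)` is absorbed into a multiple of `L`.
  set K := 1 + 3 * Real.log (8 * max c 1) with hK
  have hKL : Real.log (8 * max c 1) + L ≤ K * L := by
    rw [hK]
    nlinarith
  have hKL1 : 1 ≤ K * L := by linarith
  have hR1 : 1 ≤ (K * L) ^ α := Real.one_le_rpow hKL1 hα.le
  have hmul : (K * L) ^ α = K ^ α * L ^ α := Real.mul_rpow (by linarith) (by linarith)
  refine .of_tail h hn hk hp hε0 hℓ (m := 0) (R := (K * L) ^ α) ?_ ?_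
  · simp only [sub_zero]
    refine (hμ _ (by linarith)).trans ?_
    rw [← Real.rpow_mul (by linarith), mul_one_div_cancel hα.ne', Real.rpow_one]
    refine le_trans ?_ (mul_exp_neg_le_div hε0 h.1 (lt_max_of_lt_right one_pos) hKL)
    gcongr
    exact le_max_left _ _
  · have h1 := Nat.floor_le (show 0 ≤ (2 * (K * L) ^ α + ε / 8) / (ε / 2) by positivity)
    have e : (2 * (K * L) ^ α + ε / 8) / (ε / 2) = 4 * ((K * L) ^ α / ε) + 1 / 4 := by
      field_simp; ring
    have e' : 9 * K ^ α * (1 / ε * L ^ α) = 9 * ((K * L) ^ α / ε) := by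
      rw [hmul]; ring
    have h2 : 1 ≤ (K * L) ^ α / ε := (one_le_div hε0).2 (by linarith)
    have : ((⌊(2 * (K * L) ^ α + ε / 8) / (ε / 2)⌋₊ + 4 : ℕ) : ℝ) ≤ k := by
      push_cast
      linarith
    exact_mod_cast this

end StreamSummary

theorem mainTheorem3 :
    (∃ C : ℝ, 0 < C ∧
      ∀ (μ : Measure ℝ) [IsProbabilityMeasure μ] (σ ℓ p ε δ : ℝ) (n k : ℕ),
        0 < σ → StreamSummary.IsSubGaussian μ σ → StreamSummary.HasBiLipschitzCDF μ ℓ →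
        1 ≤ p → ε ∈ Set.Ioo (0 : ℝ) 1 → δ ∈ Set.Ioo (0 : ℝ) 1 →
        C * (Real.log (1 / δ) * max (1 / ℓ ^ 2) (ℓ ^ 2)) ≤ (n : ℝ) →
        4 ≤ k → C * (σ / ε * Real.log (ℓ / ε)) ≤ (k : ℝ) →
        StreamSummary.SCALearns μ p ε δ n k) ∧
    (∀ α c : ℝ, 0 < α → ∃ C : ℝ, 0 < C ∧
      ∀ (μ : Measure ℝ) [IsProbabilityMeasure μ] (ℓ p ε δ : ℝ) (n k : ℕ),
        StreamSummary.IsSubWeibull μ α c → StreamSummary.HasBiLipschitzCDF μ ℓ →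
        1 ≤ p → ε ∈ Set.Ioo (0 : ℝ) 1 → δ ∈ Set.Ioo (0 : ℝ) 1 →
        C * (Real.log (1 / δ) * max (1 / ε) (max (1 / ℓ ^ 2) (ℓ ^ 2))) ≤ (n : ℝ) →
        4 ≤ k → C * (1 / ε * Real.log (ℓ / ε) ^ α) ≤ (k : ℝ) →
        StreamSummary.SCALearns μ p ε δ n k) := by
  refine ⟨⟨168, by norm_num, ?_⟩, fun α c hα =>
    ⟨9 * (1 + 3 * Real.log (8 * max c 1)) ^ α, ?_, ?_⟩⟩
  · intro μ _ σ ℓ p ε δ n k hσ hμ h hp hε hδ hn hk hkC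
    have hℓ := h.1
    exact hμ.scaLearns hσ h (StreamSummary.pos_of_mul_log_mul_le (by norm_num) hδ
      (lt_max_of_lt_right (by positivity)) hn) hk hp hε.1 hkC
  · have : 0 ≤ Real.log (8 * max c 1) := Real.log_nonneg (by linarith [le_max_right c 1])
    positivity
  · intro μ _ ℓ p ε δ n k hμ h hp hε hδ hn hk hkC
    have hC : 0 < 9 * (1 + 3 * Real.log (8 * max c 1)) ^ α := by
      have : 0 ≤ Real.log (8 * max c 1) := Real.log_nonneg (by linarith [le_max_right c 1])
      positivity
    exact hμ.scaLearns hα h (StreamSummary.pos_of_mul_log_mul_le hC hδ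
      (lt_max_of_lt_left (one_div_pos.2 hε.1)) hn) hk hp hε hkC
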